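/- Let $n\ge 1$, let $p$ be a real number with $p>n$, and let $\Omega\subsetneq\mathbb R^n$ be an arbitrary domain (a non-empty connected open set, bounded or not, different from $\mathbb R^n$). Let $$\delta(x)=\min_{\xi\in\partial\Omega}|x-\xi|$$ be the distance from $x$ to the boundary of $\Omega$. Then for every real-valued $\zeta\in C_0^\infty(\Omega)$ (smooth, with compact support contained in $\Omega$) the function $|\zeta/\delta|^p$ is integrable over $\Omega$ and the Hardy inequality $$\int_\Omega\left|\frac{\zeta(x)}{\delta(x)}\right|^p dx\;\le\;\left(\frac{p}{p-n}\right)^p\int_\Omega|\nabla\zeta(x)|^p\,dx$$ holds. -/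

import Mathlib

open MeasureTheory
open scoped ContDiff Gradient

/-- A domain of `ℝⁿ`: an open, connected, non-empty set. -/
def IsDomainIn {n : ℕ} (Ω : Set (EuclideanSpace ℝ (Fin n))) : Prop :=
  IsOpen Ω ∧ IsConnected Ω

/-- The distance `δ(x) = min_{ξ ∈ ∂Ω} |x - ξ|` from `x` to the boundary of `Ω`. -/
noncomputable def boundaryDist {n : ℕ} (Ω : Set (EuclideanSpace ℝ (Fin n)))
    (x : EuclideanSpace ℝ (Fin n)) : ℝ :=
  Metric.infDist x (frontier Ω)

/-- `ζ ∈ C₀^∞(Ω)`: a smooth function whose support is a compact subset of `Ω`. -/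
def IsTestFunctionOn {n : ℕ} (Ω : Set (EuclideanSpace ℝ (Fin n)))
    (ζ : EuclideanSpace ℝ (Fin n) → ℝ) : Prop :=
  ContDiff ℝ ∞ ζ ∧ HasCompactSupport ζ ∧ tsupport ζ ⊆ Ω

open Filter Topology

/-! Write `d` for the distance to a closed set `s`. Since `d ^ 2 - ‖x‖ ^ 2` is an infimum of affine
functions, it is concave, so weakly `div (d ∇d) ≤ n`. Testing this with `φ = |ζ / d| ^ p` and using
`‖∇d‖ = 1` a.e. gives `(p - n) ∫ φ ≤ p ∫ |ζ / d| ^ (p - 1) ‖∇ζ‖`, and Young's inequality with the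
best weight yields the constant. The weak bound is `neg_integral_inner_gradient_infDist_le`,
obtained from second differences; the pointwise expansion is `mul_abs_div_infDist_rpow_le`. No
regularity of `s` is used, and `s = frontier Ω` gives the theorem. -/

/-! ### Geometry of the distance function -/

/-- Parallelogram law at a point of `s` nearest to `x`, which also bounds the distances from `x ±
h`. -/
theorem infDist_sq_add_infDist_sq_le {E : Type*} [NormedAddCommGroup E] [InnerProductSpace ℝ E]
    [ProperSpace E] {s : Set E} (hs : IsClosed s) (hne : s.Nonempty) (x h : E) :
    Metric.infDist (x + h) s ^ 2 + Metric.infDist (x - h) s ^ 2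
      ≤ 2 * Metric.infDist x s ^ 2 + 2 * ‖h‖ ^ 2 := by
  obtain ⟨y, hy, hxy⟩ := hs.exists_infDist_eq_dist hne x
  have h1 := Metric.infDist_le_dist_of_mem (x := x + h) hy
  have h2 := Metric.infDist_le_dist_of_mem (x := x - h) hy
  have e1 : x + h - y = (x - y) + h := by abel
  have e2 : x - h - y = (x - y) - h := by abel
  rw [dist_eq_norm, e1] at h1
  rw [dist_eq_norm, e2] at h2
  rw [hxy, dist_eq_norm]
  have h3 := parallelogram_law_with_norm ℝ (x - y) h
  have h1' := pow_le_pow_left₀ Metric.infDist_nonneg h1 2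
  have h2' := pow_le_pow_left₀ Metric.infDist_nonneg h2 2
  nlinarith

/-- The Lipschitz bound gives `≤ 1`; moving towards a nearest point decreases the distance at unit
rate, which gives `≥ 1`. -/
theorem norm_fderiv_infDist_eq_one {E : Type*} [NormedAddCommGroup E] [InnerProductSpace ℝ E]
    [ProperSpace E] {s : Set E} (hs : IsClosed s) (hne : s.Nonempty) {x : E} (hx : x ∉ s)
    (hd : DifferentiableAt ℝ (fun y => Metric.infDist y s) x) :
    ‖fderiv ℝ (fun y => Metric.infDist y s) x‖ = 1 := by
  apply le_antisymm
  · exact_mod_cast norm_fderiv_le_of_lipschitz ℝ (Metric.lipschitz_infDist_pt s)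
  obtain ⟨y, hy, hxy⟩ := hs.exists_infDist_eq_dist hne x
  have hpos : 0 < ‖x - y‖ := norm_pos_iff.2 (sub_ne_zero.2 fun h => hx (h ▸ hy))
  rw [dist_eq_norm] at hxy
  have hslope := (hd.hasFDerivAt.hasLineDerivAt (y - x)).tendsto_slope_zero_right
  have hle : fderiv ℝ (fun y => Metric.infDist y s) x (y - x) ≤ -‖x - y‖ := by
    refine le_of_tendsto hslope ?_
    filter_upwards [Ioo_mem_nhdsGT (zero_lt_one' ℝ)] with t ht
    have h1 := Metric.infDist_le_dist_of_mem (x := x + t • (y - x)) hy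
    have e : x + t • (y - x) - y = (1 - t) • (x - y) := by module
    rw [dist_eq_norm, e, norm_smul, Real.norm_of_nonneg (by linarith [ht.2])] at h1
    rw [hxy, smul_eq_mul, inv_mul_le_iff₀ ht.1]
    nlinarith
  have hop := (fderiv ℝ (fun y => Metric.infDist y s) x).le_opNorm (y - x)
  rw [norm_sub_rev y x, Real.norm_eq_abs] at hop
  have := neg_abs_le (fderiv ℝ (fun y => Metric.infDist y s) x (y - x))
  by_contra! hlt
  nlinarith

/-! ### Weak Laplacian bound for the squared distance -/

/-- Discrete integration by parts, from translation invariance of the measure. -/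
theorem integral_mul_second_difference {n : ℕ} {φ g : EuclideanSpace ℝ (Fin n) → ℝ}
    (hφ : Continuous φ) (hc : HasCompactSupport φ) (hg : Continuous g)
    (h : EuclideanSpace ℝ (Fin n)) :
    ∫ x, φ x * (g (x + h) + g (x - h) - 2 * g x)
      = -∫ x, (φ (x + h) - φ x) * (g (x + h) - g x) := by
  have i : ∀ f : EuclideanSpace ℝ (Fin n) → ℝ, Continuous f → Integrable (fun x => φ x * f x) :=
    fun f hf => (hφ.mul hf).integrable_of_hasCompactSupport hc.mul_right
  have i1 := i (fun x => g (x + h)) (by fun_prop)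
  have i2 := i (fun x => g (x - h)) (by fun_prop)
  have i3 := i g hg
  have i4 := i3.comp_add_right h
  have i5 := i2.comp_add_right h
  simp only [add_sub_cancel_right] at i5
  have e4 := integral_add_right_eq_self (μ := volume) (fun x => φ x * g x) h
  have e5 := integral_add_right_eq_self (μ := volume) (fun x => φ x * g (x - h)) h
  simp only [add_sub_cancel_right] at e5
  have l : ∫ x, φ x * (g (x + h) + g (x - h) - 2 * g x)
      = (∫ x, φ x * g (x + h)) + (∫ x, φ x * g (x - h)) - 2 * ∫ x, φ x * g x := by
    rw [← integral_const_mul, ← integral_add i1 i2,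
      ← integral_sub (by exact i1.add i2) (i3.const_mul 2)]
    congr 1; ext x; ring
  have r : ∫ x, (φ (x + h) - φ x) * (g (x + h) - g x)
      = (∫ x, φ (x + h) * g (x + h)) - (∫ x, φ (x + h) * g x) - (∫ x, φ x * g (x + h))
        + ∫ x, φ x * g x := by
    rw [← integral_sub i4 i5, ← integral_sub (by exact i4.sub i5) i1,
      ← integral_add (by exact (i4.sub i5).sub i1) i3]
    congr 1; ext x; ring
  rw [l, r, e4, e5]; ring

/-- Rademacher's theorem gives the a.e. limit and the Lipschitz bounds give a dominating function.
-/
theorem tendsto_integral_difference_mul_difference_sq {n : ℕ}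
    {φ d : EuclideanSpace ℝ (Fin n) → ℝ} {C : NNReal}
    (hφ : LipschitzWith C φ) (hc : HasCompactSupport φ) (hd : LipschitzWith 1 d)
    (v : EuclideanSpace ℝ (Fin n)) :
    Integrable (fun x => fderiv ℝ φ x v * (2 * d x * fderiv ℝ d x v)) ∧
    Tendsto (fun t : ℝ => ∫ x,
        (t⁻¹ * (φ (x + t • v) - φ x)) * (t⁻¹ * (d (x + t • v) ^ 2 - d x ^ 2)))
      (𝓝[>] 0) (𝓝 (∫ x, fderiv ℝ φ x v * (2 * d x * fderiv ℝ d x v))) := by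
  -- For `0 < t < 1`, both `φ x` and `φ (x + t • v)` vanish when `x` lies outside `K`.
  set K := Metric.cthickening ‖v‖ (tsupport φ) with hK
  have hKc : IsCompact K := hc.isCompact.cthickening
  set B : EuclideanSpace ℝ (Fin n) → ℝ :=
    K.indicator fun x => (C * ‖v‖) * (‖v‖ * (2 * |d x| + ‖v‖)) with hB
  have hBi : Integrable B := by
    rw [hB, integrable_indicator_iff hKc.measurableSet]
    have := hd.continuous
    exact ContinuousOn.integrableOn_compact hKc (by fun_prop)
  set F : ℝ → EuclideanSpace ℝ (Fin n) → ℝ := fun t x =>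
    (t⁻¹ * (φ (x + t • v) - φ x)) * (t⁻¹ * (d (x + t • v) ^ 2 - d x ^ 2)) with hF
  have hFc : ∀ t, Continuous (F t) := by
    intro t
    have := hd.continuous
    have := hφ.continuous
    fun_prop
  have hbd : ∀ t ∈ Set.Ioo (0 : ℝ) 1, ∀ x, ‖F t x‖ ≤ B x := by
    intro t ht x
    have ht0 := ht.1
    by_cases hx : x ∈ K
    · simp only [hB, Set.indicator_of_mem hx, hF, norm_mul]
      have e1 : ‖x + t • v - x‖ = t * ‖v‖ := by
        rw [add_sub_cancel_left, norm_smul, Real.norm_of_nonneg ht0.le]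
      have h1 := hφ.norm_sub_le (x + t • v) x
      have h2 := hd.norm_sub_le (x + t • v) x
      rw [e1] at h1 h2
      simp only [NNReal.coe_one, one_mul, Real.norm_eq_abs] at h1 h2 ⊢
      rw [abs_of_pos (inv_pos.2 ht0)]
      have h3 : |d (x + t • v) ^ 2 - d x ^ 2| ≤ (t * ‖v‖) * (2 * |d x| + ‖v‖) := by
        have e : d (x + t • v) ^ 2 - d x ^ 2
          = (d (x + t • v) - d x) * ((d (x + t • v) - d x) + 2 * d x) := by ring
        rw [e, abs_mul]
        have h4 := abs_add_le (d (x + t • v) - d x) (2 * d x)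
        rw [abs_mul 2, abs_two] at h4
        have h5 : t * ‖v‖ ≤ ‖v‖ := mul_le_of_le_one_left (norm_nonneg v) ht.2.le
        gcongr
        linarith
      refine mul_le_mul ?_ ?_ (by positivity) (by positivity)
      · rw [inv_mul_le_iff₀ ht0]; linarith
      · rw [inv_mul_le_iff₀ ht0]; linarith
    · have hxs : x ∉ tsupport φ := fun h => hx (Metric.self_subset_cthickening _ h)
      have hys : x + t • v ∉ tsupport φ := by
        intro h
        refine hx (Metric.mem_cthickening_of_dist_le x _ _ _ h ?_)
        rw [dist_eq_norm, sub_add_cancel_left, norm_neg, norm_smul, Real.norm_of_nonneg ht0.le]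
        exact mul_le_of_le_one_left (norm_nonneg v) ht.2.le
      simp [hF, hB, hx, image_eq_zero_of_notMem_tsupport hxs, image_eq_zero_of_notMem_tsupport hys]
  have hlim : ∀ᵐ x, Tendsto (fun t => F t x) (𝓝[>] 0)
      (𝓝 (fderiv ℝ φ x v * (2 * d x * fderiv ℝ d x v))) := by
    filter_upwards [hφ.ae_differentiableAt, hd.ae_differentiableAt] with x h1 h2
    have l1 := (h1.hasFDerivAt.hasLineDerivAt v).tendsto_slope_zero_right
    have l2 := ((h2.hasFDerivAt.pow 2).hasLineDerivAt v).tendsto_slope_zero_right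
    simpa using l1.mul l2
  have hsmall : ∀ᶠ t in 𝓝[>] (0 : ℝ), t ∈ Set.Ioo (0 : ℝ) 1 := Ioo_mem_nhdsGT one_pos
  refine ⟨?_, tendsto_integral_filter_of_dominated_convergence B
    (.of_forall fun t => (hFc t).aestronglyMeasurable)
    (hsmall.mono fun t ht => .of_forall (hbd t ht)) hBi hlim⟩
  refine hBi.mono' (aestronglyMeasurable_of_tendsto_ae _
    (fun t => (hFc t).aestronglyMeasurable) hlim) ?_
  filter_upwards [hlim] with x hx
  exact le_of_tendsto hx.norm (hsmall.mono fun t ht => hbd t ht x)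

/-- The weak form of `Δ (d ^ 2) ≤ 2 n` for the distance function `d` to a closed set. -/
theorem neg_integral_inner_gradient_infDist_le {n : ℕ} {s : Set (EuclideanSpace ℝ (Fin n))}
    (hs : IsClosed s) (hne : s.Nonempty) {φ : EuclideanSpace ℝ (Fin n) → ℝ} {C : NNReal}
    (hφ : LipschitzWith C φ) (hc : HasCompactSupport φ) (h0 : ∀ x, 0 ≤ φ x) :
    Integrable (fun x => Metric.infDist x s *
      inner ℝ (∇ φ x) (∇ (fun y => Metric.infDist y s) x)) ∧
    -∫ x, Metric.infDist x s * inner ℝ (∇ φ x) (∇ (fun y => Metric.infDist y s) x)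
      ≤ n * ∫ x, φ x := by
  set d : EuclideanSpace ℝ (Fin n) → ℝ := fun y => Metric.infDist y s with hd
  have hdL : LipschitzWith 1 d := Metric.lipschitz_infDist_pt s
  set b := EuclideanSpace.basisFun (Fin n) ℝ
  have key := fun i => tendsto_integral_difference_mul_difference_sq hφ hc hdL (b i)
  have hle : ∀ i, -∫ x, fderiv ℝ φ x (b i) * (2 * d x * fderiv ℝ d x (b i)) ≤ 2 * ∫ x, φ x := by
    intro i
    refine le_of_tendsto (key i).2.neg ?_
    filter_upwards [self_mem_nhdsWithin] with t (ht : 0 < t)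
    have e := integral_mul_second_difference hφ.continuous hc (g := fun x => d x ^ 2)
      (hdL.continuous.pow 2) (t • b i)
    have e1 : ∫ x, (t⁻¹ * (φ (x + t • b i) - φ x)) * (t⁻¹ * (d (x + t • b i) ^ 2 - d x ^ 2))
      = (t⁻¹ * t⁻¹) * ∫ x, (φ (x + t • b i) - φ x) * (d (x + t • b i) ^ 2 - d x ^ 2) := by
      rw [← integral_const_mul]; congr 1; ext x; ring
    have hdc := hdL.continuous
    have hφc := hφ.continuous
    have e2 : ∫ x, φ x * (d (x + t • b i) ^ 2 + d (x - t • b i) ^ 2 - 2 * d x ^ 2)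
        ≤ ∫ x, φ x * (2 * t ^ 2) := by
      refine integral_mono ?_ ?_ ?_
      · exact Continuous.integrable_of_hasCompactSupport (by fun_prop) hc.mul_right
      · exact Continuous.integrable_of_hasCompactSupport (by fun_prop) hc.mul_right
      · intro x
        have h1 := infDist_sq_add_infDist_sq_le hs hne x (t • b i)
        rw [norm_smul, b.norm_eq_one, mul_one, Real.norm_of_nonneg ht.le] at h1
        exact mul_le_mul_of_nonneg_left (by simp only [hd]; linarith) (h0 x)
    rw [e1, ← mul_neg, ← e]
    rw [integral_mul_const] at e2
    calc _ ≤ t⁻¹ * t⁻¹ * ((∫ x, φ x) * (2 * t ^ 2)) := by gcongr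
      _ = _ := by field_simp
  have hsum : ∀ x, d x * inner ℝ (∇ φ x) (∇ d x)
      = ∑ i, (1 / 2) * (fderiv ℝ φ x (b i) * (2 * d x * fderiv ℝ d x (b i))) := by
    intro x
    rw [← b.sum_inner_mul_inner, Finset.mul_sum]
    refine Finset.sum_congr rfl fun i _ => ?_
    rw [← inner_gradient_left, ← inner_gradient_left, real_inner_comm (∇ d x) (b i)]
    ring
  have hi := fun i (_ : i ∈ Finset.univ) => (key i).1.const_mul (1 / 2)
  change Integrable (fun x => d x * inner ℝ (∇ φ x) (∇ d x)) ∧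
    -∫ x, d x * inner ℝ (∇ φ x) (∇ d x) ≤ _
  simp_rw [hsum]
  refine ⟨integrable_finsetSum _ hi, ?_⟩
  rw [integral_finsetSum _ hi, ← Finset.sum_neg_distrib]
  calc _ ≤ ∑ i : Fin n, ∫ x, φ x := by
        refine Finset.sum_le_sum fun i _ => ?_
        rw [integral_const_mul]
        linarith [hle i]
    _ = _ := by simp

/-! ### Young's inequality and the test function -/

theorem mul_rpow_mul_le_weighted_young {p a b κ : ℝ} (hp : 1 < p) (ha : 0 ≤ a) (hb : 0 ≤ b)
    (hκ : 0 < κ) :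
    p * (a ^ (p - 1) * b) ≤ (p - 1) * κ * a ^ p + κ ^ (1 - p) * b ^ p := by
  have hp0 : 0 < p := by linarith
  have hp1 : 0 < p - 1 := by linarith
  have hq : (p / (p - 1)).HolderConjugate p := (Real.HolderConjugate.conjExponent hp).symm
  have h := Real.young_inequality_of_nonneg (a := κ ^ ((p - 1) / p) * a ^ (p - 1))
    (b := κ ^ (-((p - 1) / p)) * b) (by positivity) (by positivity) hq
  have e0 : κ ^ ((p - 1) / p) * a ^ (p - 1) * (κ ^ (-((p - 1) / p)) * b) = a ^ (p - 1) * b := by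
    rw [Real.rpow_neg hκ.le]
    field_simp
  have e1 : (κ ^ ((p - 1) / p) * a ^ (p - 1)) ^ (p / (p - 1)) = κ * a ^ p := by
    rw [Real.mul_rpow (by positivity) (by positivity), ← Real.rpow_mul hκ.le, ← Real.rpow_mul ha]
    have h1 : (p - 1) / p * (p / (p - 1)) = 1 := by field_simp
    have h2 : (p - 1) * (p / (p - 1)) = p := by field_simp
    rw [h1, h2, Real.rpow_one]
  have e2 : (κ ^ (-((p - 1) / p)) * b) ^ p = κ ^ (1 - p) * b ^ p := by
    rw [Real.mul_rpow (by positivity) hb, ← Real.rpow_mul hκ.le]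
    congr 2
    field_simp
    ring
  rw [e0, e1, e2] at h
  calc p * (a ^ (p - 1) * b)
      ≤ p * (κ * a ^ p / (p / (p - 1)) + κ ^ (1 - p) * b ^ p / p) := by gcongr
    _ = _ := by field_simp

theorem lipschitzOnWith_rpow_neg {p c : ℝ} (hp : 0 ≤ p) (hc : 0 < c) :
    LipschitzOnWith (p * c ^ (-p - 1)).toNNReal (fun s : ℝ => s ^ (-p)) (Set.Ici c) := by
  refine (convex_Ici c).lipschitzOnWith_of_nnnorm_deriv_le (𝕜 := ℝ) ?_ ?_
  · intro s (hs : c ≤ s)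
    exact (Real.hasDerivAt_rpow_const (.inl (hc.trans_le hs).ne')).differentiableAt
  · intro s (hs : c ≤ s)
    have hs0 := hc.trans_le hs
    rw [(Real.hasDerivAt_rpow_const (.inl hs0.ne')).deriv, ← NNReal.coe_le_coe, coe_nnnorm,
      Real.coe_toNNReal _ (by positivity), norm_mul, norm_neg, Real.norm_of_nonneg hp,
      Real.norm_of_nonneg (by positivity)]
    exact mul_le_mul_of_nonneg_left (Real.rpow_le_rpow_of_nonpos hc hs (by linarith)) hp

theorem exists_lipschitzWith_abs_div_infDist_rpow {E : Type*} [NormedAddCommGroup E]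
    [NormedSpace ℝ E] {s : Set E} (hs : IsClosed s) (hne : s.Nonempty)
    {ζ : E → ℝ} (hζ : ContDiff ℝ 1 ζ) (hc : HasCompactSupport ζ) (hsζ : Disjoint (tsupport ζ) s)
    {p : ℝ} (hp : 1 < p) :
    ∃ C, LipschitzWith C fun x => |ζ x / Metric.infDist x s| ^ p := by
  have hpos : ∀ x ∈ tsupport ζ, 0 < Metric.infDist x s := fun x hx =>
    (hs.notMem_iff_infDist_pos hne).1 (Set.disjoint_left.1 hsζ hx)
  obtain ⟨c, hc0, hcl⟩ : ∃ c, 0 < c ∧ ∀ x ∈ tsupport ζ, c ≤ Metric.infDist x s := by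
    rcases (tsupport ζ).eq_empty_or_nonempty with h | h
    · exact ⟨1, one_pos, by simp [h]⟩
    · obtain ⟨y, hy, hmin⟩ := hc.isCompact.exists_isMinOn h
        (Metric.continuous_infDist_pt s).continuousOn
      exact ⟨_, hpos y hy, fun x hx => hmin hx⟩
  set F : E → ℝ := fun x => |ζ x| ^ p with hF
  have hF1 : ContDiff ℝ 1 F := hζ.norm_rpow hp
  have hFc : HasCompactSupport F :=
    hc.comp_left (g := fun t : ℝ => |t| ^ p) (by simp [(zero_lt_one.trans hp).ne'])
  obtain ⟨A, hA⟩ := hF1.lipschitzWith_of_hasCompactSupport hFc (𝕂 := ℝ) one_ne_zero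
  obtain ⟨M, hM⟩ := hFc.exists_bound_of_continuous hF1.continuous
  -- Truncating the distance at its lower bound `c` on the support makes the negative power globally
  -- Lipschitz without changing the product with `F`.
  set m : E → ℝ := fun x => (max (Metric.infDist x s) c) ^ (-p) with hm
  have hmL : LipschitzWith ((p * c ^ (-p - 1)).toNNReal * 1) m := by
    rw [← lipschitzOnWith_univ]
    refine (lipschitzOnWith_rpow_neg (by linarith) hc0).comp
      (((Metric.lipschitz_infDist_pt s).max_const c).lipschitzOnWith) ?_
    exact fun x _ => Set.mem_Ici.2 (le_max_right _ _)
  have hmb : ∀ x, ‖m x‖ ≤ c ^ (-p) := by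
    intro x
    have : 0 < max (Metric.infDist x s) c := lt_max_of_lt_right hc0
    rw [Real.norm_of_nonneg (by positivity)]
    exact Real.rpow_le_rpow_of_nonpos hc0 (le_max_right _ _) (by linarith)
  have e : (fun x => |ζ x / Metric.infDist x s| ^ p) = fun x => F x * m x := by
    ext x
    by_cases hx : x ∈ tsupport ζ
    · have := hpos x hx
      rw [abs_div, abs_of_pos this, Real.div_rpow (abs_nonneg _) this.le, hF, hm]
      simp only
      rw [max_eq_left (hcl x hx), Real.rpow_neg this.le, div_eq_mul_inv]
    · simp [hF, image_eq_zero_of_notMem_tsupport hx, (zero_lt_one.trans hp).ne']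
  rw [e]
  refine ⟨_, LipschitzWith.of_dist_le' (K := A * c ^ (-p) + M * (p * c ^ (-p - 1))) fun x y => ?_⟩
  have h1 := hA.dist_le_mul x y
  have h2 := hmL.dist_le_mul x y
  rw [mul_one, Real.coe_toNNReal _ (by positivity)] at h2
  rw [Real.dist_eq, ← Real.norm_eq_abs] at *
  have e : F x * m x - F y * m y = (F x - F y) * m x + F y * (m x - m y) := by ring
  rw [e]
  have hM0 : 0 ≤ M := (norm_nonneg _).trans (hM y)
  calc _ ≤ ‖F x - F y‖ * ‖m x‖ + ‖F y‖ * ‖m x - m y‖ := by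
        refine (norm_add_le _ _).trans ?_
        rw [norm_mul, norm_mul]
    _ ≤ (A * dist x y) * c ^ (-p) + M * (p * c ^ (-p - 1) * dist x y) := by
        gcongr
        · exact hmb x
        · exact hM y
    _ = _ := by ring

/-- Product rule for `|ζ| ^ p * d ^ (-p)`: by `‖∇d‖ = 1`, differentiating `d ^ (-p)` produces the
left side. The only loss is Cauchy–Schwarz on `⟪∇ζ, ∇d⟫`. -/
theorem mul_abs_div_infDist_rpow_le {n : ℕ} {s : Set (EuclideanSpace ℝ (Fin n))}
    (hs : IsClosed s) (hne : s.Nonempty) {ζ : EuclideanSpace ℝ (Fin n) → ℝ}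
    (hζ : ContDiff ℝ 1 ζ) (hsζ : Disjoint (tsupport ζ) s) {p : ℝ} (hp : 1 < p)
    {x : EuclideanSpace ℝ (Fin n)} (hx : DifferentiableAt ℝ (fun y => Metric.infDist y s) x) :
    p * |ζ x / Metric.infDist x s| ^ p
      ≤ -(Metric.infDist x s * inner ℝ (∇ (fun y => |ζ y / Metric.infDist y s| ^ p) x)
          (∇ (fun y => Metric.infDist y s) x))
        + p * (|ζ x / Metric.infDist x s| ^ (p - 1) * ‖∇ ζ x‖) := by
  have hp0 : 0 < p := by linarith
  by_cases hxs : x ∈ tsupport ζ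
  swap
  · have h0 : ζ x = 0 := image_eq_zero_of_notMem_tsupport hxs
    have hev : (fun y => |ζ y / Metric.infDist y s| ^ p) =ᶠ[𝓝 x] fun _ => 0 := by
      filter_upwards [notMem_tsupport_iff_eventuallyEq.1 hxs] with y hy
      simp [hy, hp0.ne']
    have hg : ∇ (fun y => |ζ y / Metric.infDist y s| ^ p) x = 0 := by
      simp [gradient, hev.fderiv_eq]
    have hp1 : p - 1 ≠ 0 := by linarith
    simp [hg, h0, hp0.ne', hp1]
  have hxs' : x ∉ s := Set.disjoint_left.1 hsζ hxs
  have hd0 : 0 < Metric.infDist x s := (hs.notMem_iff_infDist_pos hne).1 hxs'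
  have hfun : (fun y => |ζ y / Metric.infDist y s| ^ p)
      = fun y => |ζ y| ^ p * Metric.infDist y s ^ (-p) := by
    ext y
    rw [abs_div, abs_of_nonneg Metric.infDist_nonneg,
      Real.div_rpow (abs_nonneg _) Metric.infDist_nonneg, Real.rpow_neg Metric.infDist_nonneg,
      div_eq_mul_inv]
  have hnorm := norm_fderiv_infDist_eq_one hs hne hxs' hx
  set d : EuclideanSpace ℝ (Fin n) → ℝ := fun y => Metric.infDist y s with hd
  have hgd : ‖∇ d x‖ = 1 := by
    rw [← hnorm]; simp [gradient]
  have D1 := (hasDerivAt_abs_rpow (ζ x) hp).comp_hasFDerivAt x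
    (hζ.differentiable one_ne_zero x).hasFDerivAt
  have D2 := (Real.hasDerivAt_rpow_const (x := d x) (p := -p) (.inl hd0.ne')).comp_hasFDerivAt x
    hx.hasFDerivAt
  have D := (D1.mul D2).fderiv
  have hin : inner ℝ (∇ (fun y => |ζ y / Metric.infDist y s| ^ p) x) (∇ d x)
      = |ζ x| ^ p * (-p * d x ^ (-p - 1))
        + d x ^ (-p) * (p * |ζ x| ^ (p - 2) * ζ x * inner ℝ (∇ ζ x) (∇ d x)) := by
    rw [inner_gradient_left, inner_gradient_left, hfun]
    have hdd : fderiv ℝ d x (∇ d x) = 1 := by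
      rw [← inner_gradient_left, real_inner_self_eq_norm_sq, hgd, one_pow]
    change fderiv ℝ ((fun t => |t| ^ p) ∘ ζ * (fun t => t ^ (-p)) ∘ d) x (∇ d x) = _
    rw [D]
    simp [hdd]
  have hY : p * |ζ x| ^ (p - 2) * ζ x * inner ℝ (∇ ζ x) (∇ d x)
      ≤ p * (|ζ x| ^ (p - 1) * ‖∇ ζ x‖) := by
    have h1 := abs_real_inner_le_norm (∇ ζ x) (∇ d x)
    rw [hgd, mul_one] at h1
    have h2 : |ζ x| ^ (p - 1) = |ζ x| ^ (p - 2) * |ζ x| := by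
      rw [← Real.rpow_add_one' (abs_nonneg _) (by linarith)]
      ring_nf
    rw [h2, mul_assoc, mul_assoc]
    refine mul_le_mul_of_nonneg_left ?_ hp0.le
    rw [mul_assoc]
    refine mul_le_mul_of_nonneg_left ((le_abs_self _).trans ?_) (by positivity)
    rw [abs_mul]
    gcongr
  rw [hin]
  change p * |ζ x / d x| ^ p ≤ -(d x * _) + p * (|ζ x / d x| ^ (p - 1) * ‖∇ ζ x‖)
  change 0 < d x at hd0
  rw [abs_div, abs_of_pos hd0, Real.div_rpow (abs_nonneg _) hd0.le,
    Real.div_rpow (abs_nonneg _) hd0.le, Real.rpow_sub_one hd0.ne', Real.rpow_sub_one hd0.ne',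
    Real.rpow_neg hd0.le]
  have hP : 0 < d x ^ p := by positivity
  have h := mul_le_mul_of_nonneg_left hY (by positivity : 0 ≤ d x / d x ^ p)
  calc p * (|ζ x| ^ p / d x ^ p) ≤ p * (|ζ x| ^ p / d x ^ p) + (d x / d x ^ p * (p * (|ζ x| ^ (p - 1) * ‖∇ ζ x‖))
        - d x / d x ^ p * (p * |ζ x| ^ (p - 2) * ζ x * inner ℝ (∇ ζ x) (∇ d x))) := by linarith
    _ = _ := by
        generalize d x ^ p = P at hP ⊢
        generalize d x = r at hd0 ⊢
        field_simp
        ring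

/-! ### The Hardy inequality -/

/-- The Hardy inequality for functions vanishing near a closed set. -/
theorem integral_abs_div_infDist_rpow_le {n : ℕ} {s : Set (EuclideanSpace ℝ (Fin n))}
    (hs : IsClosed s) (hne : s.Nonempty) {ζ : EuclideanSpace ℝ (Fin n) → ℝ}
    (hζ : ContDiff ℝ 1 ζ) (hc : HasCompactSupport ζ) (hsζ : Disjoint (tsupport ζ) s) {p : ℝ}
    (hp : 1 < p) (hnp : n < p) :
    Integrable (fun x => |ζ x / Metric.infDist x s| ^ p) ∧
      ∫ x, |ζ x / Metric.infDist x s| ^ p ≤ (p / (p - n)) ^ p * ∫ x, ‖∇ ζ x‖ ^ p := by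
  have hp0 : 0 < p := by linarith
  obtain ⟨C, hC⟩ := exists_lipschitzWith_abs_div_infDist_rpow hs hne hζ hc hsζ hp
  set φ : EuclideanSpace ℝ (Fin n) → ℝ := fun x => |ζ x / Metric.infDist x s| ^ p with hφ
  have hφc : HasCompactSupport φ := by
    refine hc.mono fun x hx hx0 => hx ?_
    simp [hφ, hx0, hp0.ne']
  have hφi : Integrable φ := hC.continuous.integrable_of_hasCompactSupport hφc
  refine ⟨hφi, ?_⟩
  obtain ⟨hGi, hG⟩ := neg_integral_inner_gradient_infDist_le hs hne hC hφc
    (fun x => by positivity)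
  have hgrad : Continuous (∇ ζ) :=
    (InnerProductSpace.toDual ℝ _).symm.continuous.comp (hζ.continuous_fderiv one_ne_zero)
  have hgradc : HasCompactSupport (∇ ζ) :=
    (hc.fderiv ℝ).comp_left (map_zero (InnerProductSpace.toDual ℝ _).symm)
  have hBi : Integrable (fun x => ‖∇ ζ x‖ ^ p) := by
    refine Continuous.integrable_of_hasCompactSupport
      (hgrad.norm.rpow_const fun _ => .inr hp0.le) ?_
    exact hgradc.comp_left (g := fun v => ‖v‖ ^ p) (by simp [hp0.ne'])
  -- This weight optimises the constant: as `p - n = p κ`, absorbing `(p - 1) κ ∫ φ` leaves `κ ∫ φ`,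
  -- hence the factor `κ ^ (-p)`.
  set κ := (p - n) / p with hκ
  have hκ0 : 0 < κ := div_pos (by linarith) hp0
  have hpt : ∀ᵐ x, p * φ x ≤ -(Metric.infDist x s *
      inner ℝ (∇ φ x) (∇ (fun y => Metric.infDist y s) x))
      + ((p - 1) * κ * φ x + κ ^ (1 - p) * ‖∇ ζ x‖ ^ p) := by
    filter_upwards [(Metric.lipschitz_infDist_pt s).ae_differentiableAt] with x hx
    have h1 := mul_abs_div_infDist_rpow_le hs hne hζ hsζ hp hx
    have h2 := mul_rpow_mul_le_weighted_young hp (abs_nonneg (ζ x / Metric.infDist x s))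
      (norm_nonneg (∇ ζ x)) hκ0
    exact h1.trans (by gcongr)
  have hint := integral_mono_ae (hφi.const_mul p)
    (hGi.neg.add ((hφi.const_mul ((p - 1) * κ)).add (hBi.const_mul (κ ^ (1 - p))))) hpt
  rw [integral_add' hGi.neg ((hφi.const_mul _).add (hBi.const_mul _)),
    integral_add' (hφi.const_mul _) (hBi.const_mul _), integral_neg', integral_const_mul,
    integral_const_mul, integral_const_mul] at hint
  have hn : (n : ℝ) = p - p * κ := by rw [hκ]; field_simp; ring
  rw [hn] at hG
  have hfin : κ * ∫ x, φ x ≤ κ ^ (1 - p) * ∫ x, ‖∇ ζ x‖ ^ p := by nlinarith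
  have hcst : (p / (p - n)) ^ p = κ⁻¹ * κ ^ (1 - p) := by
    rw [← inv_div, ← hκ, Real.inv_rpow hκ0.le, Real.rpow_sub hκ0, Real.rpow_one]
    field_simp
  rw [hcst, mul_assoc, ← div_eq_inv_mul, le_div_iff₀ hκ0, mul_comm]
  exact hfin

theorem mainTheorem2 (n : ℕ) (p : ℝ) (hp : (n : ℝ) < p)
    (Ω : Set (EuclideanSpace ℝ (Fin n))) (hΩ : IsDomainIn Ω) (hΩ' : Ω ≠ Set.univ)
    (ζ : EuclideanSpace ℝ (Fin n) → ℝ) (hζ : IsTestFunctionOn Ω ζ) :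
    IntegrableOn (fun x => |ζ x / boundaryDist Ω x| ^ p) Ω volume ∧
      ∫ x in Ω, |ζ x / boundaryDist Ω x| ^ p ∂volume ≤
        (p / (p - n)) ^ p * ∫ x in Ω, ‖∇ ζ x‖ ^ p ∂volume := by
  obtain ⟨hsm, hc, hsub⟩ := hζ
  obtain ⟨hopen, hconn⟩ := hΩ
  -- In dimension zero a non-empty set is the whole space; hence `1 ≤ n < p`.
  have hn : 1 ≤ n := by
    rcases Nat.eq_zero_or_pos n with rfl | h
    · exact absurd (Subsingleton.eq_univ_of_nonempty hconn.nonempty) hΩ'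
    · exact h
  have hp1 : 1 < p := lt_of_le_of_lt (by exact_mod_cast hn) hp
  have hp0 : p ≠ 0 := by linarith
  have hdisj : Disjoint (tsupport ζ) (frontier Ω) :=
    (disjoint_frontier_iff_isOpen.2 hopen).symm.mono_left hsub
  obtain ⟨hi, hle⟩ := integral_abs_div_infDist_rpow_le isClosed_frontier
    (nonempty_frontier_iff.2 ⟨hconn.nonempty, hΩ'⟩) (hsm.of_le (by simp)) hc hdisj hp1 hp
  refine ⟨hi.integrableOn, ?_⟩
  rw [setIntegral_eq_integral_of_forall_compl_eq_zero,
    setIntegral_eq_integral_of_forall_compl_eq_zero]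
  · exact hle
  · intro x hx
    have hx' : x ∉ tsupport ζ := fun h => hx (hsub h)
    have h0 : fderiv ℝ ζ x = 0 := fderiv_of_notMem_tsupport ℝ hx'
    simp [gradient, h0, hp0]
  · intro x hx
    have hx' : x ∉ tsupport ζ := fun h => hx (hsub h)
    simp [image_eq_zero_of_notMem_tsupport hx', hp0]
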